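/- For a topological space $X$, a transfinite sequence $\{x_\alpha:\alpha<\kappa\}$ of points of $X$ is free if $\overline{\{x_\alpha:\alpha<\beta\}}\cap\overline{\{x_\alpha:\beta\le\alpha<\kappa\}}=\emptyset$ for every $\beta<\kappa$, and $F(X)$ denotes the supremum of the cardinalities of free sequences in $X$. The space $X$ is pseudoradial if for every non-closed set $A\subset X$ there are a point $x\in\overline{A}\setminus A$ and a transfinite sequence $\{x_\alpha:\alpha<\kappa\}\subset A$ which converges to $x$, that is, every neighbourhood of $x$ contains $\{x_\alpha:\beta\le\alpha<\kappa\}$ for some $\beta<\kappa$. Let $X_\delta$ denote the set $X$ with the topology generated by the $G_\delta$-subsets of $X$. Corollary 3.4. Let $X$ be a Lindelöf Hausdorff pseudoradial space. Then $F(X_\delta)\le 2^{F(X)}$. -/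

import Mathlib

open Cardinal Set
open scoped Topology

universe u

/-- The transfinite sequence `{x α : α < κ}` (only the values of `x` below `κ` matter)
is *free*: for every `β < κ` the initial segment below `β` and the final segment from `β` on
have disjoint closures. -/
def IsFreeSequence {X : Type u} [TopologicalSpace X] (κ : Ordinal.{u}) (x : Ordinal.{u} → X) :
    Prop :=
  ∀ β < κ, Disjoint (closure (x '' Iio β)) (closure (x '' Ico β κ))

/-- The cardinalities of the free sequences of `X`. -/
def freeSequenceCardinals (X : Type u) [TopologicalSpace X] : Set Cardinal.{u} :=
  {c | ∃ (κ : Ordinal.{u}) (x : Ordinal.{u} → X), IsFreeSequence κ x ∧ #(x '' Iio κ) = c}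

/-- The cardinalities of free sequences form a bounded set, so that their supremum is a genuine
supremum. -/
theorem bddAbove_freeSequenceCardinals (X : Type u) [TopologicalSpace X] :
    BddAbove (freeSequenceCardinals X) := by
  refine ⟨#X, ?_⟩
  rintro c ⟨κ, x, -, rfl⟩
  exact mk_set_le _

/-- `F(X)`: the supremum of the cardinalities of the free sequences in `X`. -/
noncomputable def freeSequenceNumber (X : Type u) [TopologicalSpace X] : Cardinal.{u} :=
  sSup (freeSequenceCardinals X)

/-- The transfinite sequence `{x α : α < κ}` converges to `p`: every neighbourhood of `p` contains
a final segment of it. (The final segment starts at some `β < κ`, so that a sequence of length `0`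
converges to nothing.) -/
def TransfiniteConverges {X : Type u} [TopologicalSpace X] (κ : Ordinal.{u})
    (x : Ordinal.{u} → X) (p : X) : Prop :=
  ∀ U ∈ 𝓝 p, ∃ β < κ, ∀ α, β ≤ α → α < κ → x α ∈ U

/-- `X` is *pseudoradial*: every non-closed set `A` contains a transfinite sequence that converges
to a point of `closure A \ A`. -/
def IsPseudoradial (X : Type u) [TopologicalSpace X] : Prop :=
  ∀ A : Set X, ¬ IsClosed A →
    ∃ p ∈ closure A \ A, ∃ (κ : Ordinal.{u}) (x : Ordinal.{u} → X),
      (∀ α < κ, x α ∈ A) ∧ TransfiniteConverges κ x p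

/-- `X_δ`, the `G_δ`-modification of `X`: the same set of points, with the topology generated by
the `G_δ`-subsets of `X` (given by the instance below). -/
def GDeltaModification (X : Type u) : Type u := X

instance (X : Type u) [TopologicalSpace X] : TopologicalSpace (GDeltaModification X) :=
  TopologicalSpace.generateFrom (α := X) {s : Set X | IsGδ s}

/-! Let κ = F(X) be infinite; finite X is immediate because finite sets of points are free
sequences.

First, X has tightness at most κ (`IsPseudoradial.tightnessLE`). Otherwise some transfinite sequence
converges to a point outside the closure of every set of at most κ of its terms. By Lindelöfness a
G_δ-set around the limit, which contains a tail, is separated from each such closure, and recursion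
yields a free sequence of length κ⁺.

Next, closing-off arguments give two bounds of 2^κ: for subcovers of G_δ-covers
(`TightnessLE.exists_gDelta_subcover`) and for the tightness of X_δ
(`TightnessLE.exists_gDelta_closure`). By the first, a sequence of length (2^κ)⁺ has a point in the
X_δ-closure of every tail. By the second, that point is also in the X_δ-closure of an initial
segment, so the sequence is not free. -/

/-! ### Closing off under operations on sequences of small sets -/

/-- The stages of closing off the point `a` under the set-valued operation `Φ`, which takes
sequences of sets of cardinality at most `κ` as arguments. -/
noncomputable def closingOff {α : Type u} (κ : Cardinal.{u}) (Φ : (ℕ → Set α) → Set α) (a : α)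
    (i : Ordinal.{u}) : Set α :=
  {a} ∪ ⋃ B ∈ {B : ℕ → Set α | ∀ n, B n ⊆ (⋃ j : Iio i, closingOff κ Φ a j) ∧ #(B n) ≤ κ}, Φ B
termination_by i
decreasing_by exact j.2

theorem closingOff_mono {α : Type u} (κ : Cardinal.{u}) (Φ : (ℕ → Set α) → Set α) (a : α) :
    Monotone (closingOff κ Φ a) := by
  intro i j hij
  rw [closingOff, closingOff]
  refine union_subset_union_right _ (biUnion_subset_biUnion_left ?_)
  intro B hB n
  refine ⟨(hB n).1.trans (iUnion_subset fun k => ?_), (hB n).2⟩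
  exact subset_iUnion_of_subset ⟨k, lt_of_lt_of_le k.2 hij⟩ subset_rfl

theorem two_power_power_self {κ : Cardinal.{u}} (hκ : ℵ₀ ≤ κ) :
    ((2 : Cardinal.{u}) ^ κ) ^ κ = 2 ^ κ := by
  rw [← power_mul, mul_eq_self hκ]

theorem aleph0_le_two_power {κ : Cardinal.{u}} (hκ : ℵ₀ ≤ κ) :
    ℵ₀ ≤ (2 : Cardinal.{u}) ^ κ :=
  hκ.trans (cantor κ).le

theorem mk_seq_bounded_subset_le {α : Type u} {κ : Cardinal.{u}} (hκ : ℵ₀ ≤ κ) {D : Set α}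
    (hD : #D ≤ 2 ^ κ) :
    #{B : ℕ → Set α | ∀ n, B n ⊆ D ∧ #(B n) ≤ κ} ≤ 2 ^ κ := by
  have h1 : #{t : Set α // t ⊆ D ∧ #t ≤ κ} ≤ 2 ^ κ := by
    refine (mk_bounded_subset_le D κ).trans ?_
    rw [← two_power_power_self hκ]
    exact power_le_power_right (max_le hD (aleph0_le_two_power hκ))
  have h2 : #{B : ℕ → Set α | ∀ n, B n ⊆ D ∧ #(B n) ≤ κ}
      ≤ #(ℕ → {t : Set α // t ⊆ D ∧ #t ≤ κ}) := by
    refine mk_le_of_injective (f := fun B n => ⟨B.1 n, B.2 n⟩) ?_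
    intro B B' h
    ext n : 2
    exact congrArg Subtype.val (congrFun h n)
  refine h2.trans ?_
  rw [mk_arrow]
  simp only [lift_uzero, mk_nat, lift_aleph0]
  calc _ ≤ ((2 : Cardinal.{u}) ^ κ) ^ (ℵ₀ : Cardinal.{u}) := power_le_power_right h1
    _ ≤ ((2 : Cardinal.{u}) ^ κ) ^ κ :=
      power_le_power_left (power_ne_zero _ two_ne_zero) hκ
    _ = 2 ^ κ := two_power_power_self hκ

theorem mk_closingOff_le {α : Type u} {κ : Cardinal.{u}} (hκ : ℵ₀ ≤ κ)
    (Φ : (ℕ → Set α) → Set α) (hΦ : ∀ B, #(Φ B) ≤ 2 ^ κ) (a : α) (i : Ordinal.{u})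
    (hi : i < (Order.succ κ).ord) : #(closingOff κ Φ a i) ≤ 2 ^ κ := by
  have hℵ := aleph0_le_two_power hκ
  induction i using WellFoundedLT.induction with
  | _ i ih =>
    have hci : i.card ≤ 2 ^ κ :=
      (Order.lt_succ_iff.1 (lt_ord.1 hi)).trans (cantor κ).le
    have hD : #(⋃ j : Iio i, closingOff κ Φ a j : Set α) ≤ 2 ^ κ := by
      have := mk_biUnion_le_of_le hci hℵ (closingOff κ Φ a)
        (fun j hj => ih j hj (hj.trans hi))
      rwa [← biUnion_eq_iUnion (Iio i) (fun j _ => closingOff κ Φ a j)]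
    rw [closingOff]
    refine (mk_union_le _ _).trans (add_le_of_le hℵ ?_ ?_)
    · rw [mk_singleton]
      exact one_le_aleph0.trans hℵ
    · refine (mk_biUnion_le _ _).trans ?_
      refine (mul_le_mul' (mk_seq_bounded_subset_le hκ hD) (ciSup_le' fun _ => hΦ _)).trans_eq ?_
      exact mul_eq_self hℵ

/-- Closing off: a point lies in a set of cardinality at most `2 ^ κ` that is closed under an
operation which takes a sequence of sets of cardinality at most `κ` to a set of cardinality
at most `2 ^ κ`. -/
theorem exists_closed_under {α : Type u} {κ : Cardinal.{u}} (hκ : ℵ₀ ≤ κ)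
    (Φ : (ℕ → Set α) → Set α) (hΦ : ∀ B, #(Φ B) ≤ 2 ^ κ) (a : α) :
    ∃ C : Set α, a ∈ C ∧ #C ≤ 2 ^ κ ∧
      ∀ B : ℕ → Set α, (∀ n, B n ⊆ C) → (∀ n, #(B n) ≤ κ) → Φ B ⊆ C := by
  have hreg := isRegular_succ hκ
  have hκs : κ < (Order.succ κ).ord.cof := by
    rw [hreg.cof_ord]
    exact Order.lt_succ κ
  refine ⟨⋃ i < (Order.succ κ).ord, closingOff κ Φ a i, ?_, ?_, ?_⟩
  · simp only [mem_iUnion]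
    refine ⟨0, hreg.ord_pos, ?_⟩
    rw [closingOff]
    exact Or.inl rfl
  · refine mk_biUnion_le_of_le ?_ (aleph0_le_two_power hκ) _ (mk_closingOff_le hκ Φ hΦ a)
    rw [card_ord]
    exact Order.succ_le_of_lt (cantor κ)
  · intro B hBC hB
    have hstage : ∀ b : (⋃ n, B n : Set α), ∃ i < (Order.succ κ).ord, b.1 ∈ closingOff κ Φ a i := by
      rintro ⟨b, hb⟩
      obtain ⟨n, hn⟩ := mem_iUnion.1 hb
      simpa using hBC n hn
    choose s hs hbs using hstage
    have hcard : #(⋃ n, B n : Set α) ≤ κ := by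
      have h := mk_iUnion_le_lift.{u, 0} B
      simp only [lift_uzero, mk_nat, lift_aleph0] at h
      refine h.trans ?_
      exact (mul_le_mul' hκ (ciSup_le' hB)).trans_eq (mul_eq_self hκ)
    -- By regularity of κ⁺ all these points appear before a common stage; `+ 1` is needed because a
    -- stage only uses strictly earlier ones.
    have hsup : (⨆ b, s b + 1) < (Order.succ κ).ord :=
      Ordinal.iSup_add_one_lt_of_lt_cof (hcard.trans_lt hκs) hs
    intro y hy
    simp only [mem_iUnion]
    refine ⟨_, hsup, ?_⟩
    rw [closingOff]
    refine Or.inr (mem_biUnion (x := B) (fun n => ⟨fun b hb => ?_, hB n⟩) hy)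
    have hb' : b ∈ ⋃ n, B n := mem_iUnion.2 ⟨n, hb⟩
    refine mem_iUnion.2 ⟨⟨s ⟨b, hb'⟩, ?_⟩, hbs ⟨b, hb'⟩⟩
    have := Ordinal.le_iSup (fun b => s b + 1) ⟨b, hb'⟩
    exact lt_of_lt_of_le (lt_add_of_pos_right _ zero_lt_one) this

/-! ### Free sequences and tightness -/

/-- The tightness of `X` is at most `κ`. -/
def TightnessLE (X : Type u) [TopologicalSpace X] (κ : Cardinal.{u}) : Prop :=
  ∀ (A : Set X) (p : X), p ∈ closure A → ∃ B ⊆ A, #B ≤ κ ∧ p ∈ closure B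

/-- Hausdorff separation of `p` from each point of `K` gives an open cover of `K`; a countable
subcover leaves countably many neighbourhoods of `p` to intersect. -/
theorem exists_separation_of_isClosed {X : Type u} [TopologicalSpace X] [T2Space X]
    [LindelofSpace X] {K : Set X} (hK : IsClosed K) {p : X} (hp : p ∉ K) :
    ∃ V : ℕ → Set X, (∀ n, IsOpen (V n)) ∧ (∀ n, p ∈ V n) ∧
      ∃ W, IsOpen W ∧ K ⊆ W ∧ Disjoint W (⋂ n, V n) := by
  by_cases hne : K.Nonempty
  · have hsep : ∀ y : K, ∃ O V : Set X, IsOpen O ∧ IsOpen V ∧ y.1 ∈ O ∧ p ∈ V ∧ Disjoint O V :=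
      fun y => t2_separation fun h => hp (h ▸ y.2)
    choose O V hO hV hyO hpV hOV using hsep
    have : Nonempty K := hne.to_subtype
    obtain ⟨f, hf⟩ := hK.isLindelof.indexed_countable_subcover O hO
      fun y hy => mem_iUnion.2 ⟨⟨y, hy⟩, hyO _⟩
    refine ⟨fun n => V (f n), fun n => hV _, fun n => hpV _, ⋃ n, O (f n),
      isOpen_iUnion fun n => hO _, hf, ?_⟩
    rw [disjoint_iUnion_left]
    exact fun n => (hOV (f n)).mono_right (iInter_subset _ n)
  · rw [not_nonempty_iff_eq_empty] at hne
    exact ⟨fun _ => univ, fun _ => isOpen_univ, fun _ => mem_univ _, ∅, isOpen_empty,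
      hne.subset, by simp⟩

theorem IsFreeSequence.injOn {X : Type u} [TopologicalSpace X] {κ : Ordinal.{u}}
    {x : Ordinal.{u} → X} (hx : IsFreeSequence κ x) : InjOn x (Iio κ) := by
  have key : ∀ α < κ, ∀ β < κ, α < β → x α ≠ x β := by
    intro α _ β hβ hαβ h
    refine (hx β hβ).ne_of_mem (subset_closure ⟨α, hαβ, rfl⟩)
      (subset_closure ⟨β, ⟨le_rfl, hβ⟩, rfl⟩) h
  intro α hα β hβ h
  rcases lt_trichotomy α β with hlt | rfl | hlt
  · exact absurd h (key α hα β hβ hlt)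
  · rfl
  · exact absurd h.symm (key β hβ α hα hlt)

theorem IsFreeSequence.mk_image {X : Type u} [TopologicalSpace X] {κ : Ordinal.{u}}
    {x : Ordinal.{u} → X} (hx : IsFreeSequence κ x) : #(x '' Iio κ) = κ.card := by
  have h := mk_image_eq_of_injOn_lift x (Iio κ) hx.injOn
  rw [mk_Iio_ordinal, lift_lift, lift_inj.{u, u+1}.symm] at *
  simpa using h

theorem IsFreeSequence.card_le {X : Type u} [TopologicalSpace X] {κ : Ordinal.{u}}
    {x : Ordinal.{u} → X} (hx : IsFreeSequence κ x) : κ.card ≤ freeSequenceNumber X :=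
  le_csSup (bddAbove_freeSequenceCardinals X) ⟨κ, x, hx, hx.mk_image⟩

theorem IsFreeSequence.mono {X : Type u} [TopologicalSpace X] {κ μ : Ordinal.{u}}
    {x : Ordinal.{u} → X} (hx : IsFreeSequence κ x) (h : μ ≤ κ) : IsFreeSequence μ x :=
  fun β hβ => (hx β (hβ.trans_le h)).mono_right
    (closure_mono (image_mono (Ico_subset_Ico_right h)))

/-- A transfinite sequence whose length has cofinality at most `κ` contains a set of cardinality
at most `κ` in whose closure each of its limits lies. -/
theorem TransfiniteConverges.exists_mk_le {X : Type u} [TopologicalSpace X] {κ : Cardinal.{u}}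
    {μ : Ordinal.{u}} {x : Ordinal.{u} → X} {p : X} (h : TransfiniteConverges μ x p)
    (hμ : μ.cof ≤ κ) : ∃ B ⊆ x '' Iio μ, #B ≤ κ ∧ p ∈ closure B := by
  obtain ⟨s, hs, hcard⟩ := Order.exists_cof_eq μ.ToType
  rw [Ordinal.cof_toType] at hcard
  refine ⟨(fun i : μ.ToType => x (Ordinal.ToType.toOrd i).1) '' s, ?_,
    mk_image_le.trans (hcard.trans_le hμ), ?_⟩
  · rintro _ ⟨i, -, rfl⟩
    exact ⟨_, (Ordinal.ToType.toOrd i).2, rfl⟩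
  · rw [mem_closure_iff_nhds]
    intro U hU
    obtain ⟨β, hβ, hU⟩ := h U hU
    obtain ⟨i, his, hi⟩ := hs (Ordinal.ToType.mk ⟨β, hβ⟩)
    refine ⟨_, hU _ ?_ (Ordinal.ToType.toOrd i).2, ⟨i, his, rfl⟩⟩
    have : (⟨β, hβ⟩ : Iio μ) ≤ Ordinal.ToType.mk.symm i := by
      simpa using Ordinal.ToType.mk.symm.monotone hi
    exact this

/-- If a limit of a sequence whose length has cofinality greater than `κ` is not in the closure of
any set of at most `κ` terms, then the sequence has a free subsequence of length `κ⁺`. -/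
theorem exists_isFreeSequence_of_transfiniteConverges {X : Type u} [TopologicalSpace X]
    [T2Space X] [LindelofSpace X] {κ : Cardinal.{u}} (hκ : ℵ₀ ≤ κ) {μ : Ordinal.{u}}
    {x : Ordinal.{u} → X} {p : X} (h : TransfiniteConverges μ x p) (hμ : κ < μ.cof)
    (hp : ∀ B ⊆ x '' Iio μ, #B ≤ κ → p ∉ closure B) :
    ∃ y : Ordinal.{u} → X, IsFreeSequence (Order.succ κ).ord y := by
  have step : ∀ S : Set Ordinal.{u}, S ⊆ Iio μ → #S ≤ lift.{u+1} κ →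
      ∃ γ < μ, (∀ α ∈ S, α ≤ γ) ∧ Disjoint (closure (x '' S)) (closure (x '' Ico γ μ)) := by
    intro S hS hcard
    have hB : #(x '' S) ≤ κ := by
      have := mk_image_le_lift (f := x) (s := S)
      rw [← lift_le.{u+1}]
      refine this.trans ?_
      rw [lift_id'.{u, u+1}]
      exact hcard
    obtain ⟨V, hV, hpV, W, hW, hKW, hWV⟩ :=
      exists_separation_of_isClosed isClosed_closure (hp _ (image_mono hS) hB)
    choose b hbμ hb using fun n => h (V n) ((hV n).mem_nhds (hpV n))
    -- The cofinality of `μ` is uncountable, so one tail lies in every `V n`.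
    have hsupb : (⨆ n, b n) < μ := by
      refine Ordinal.lift_iSup_lt_of_lt_cof (f := b) ?_ hbμ
      simpa using hκ.trans_lt hμ
    have hsupS : sSup S < μ := by
      refine Ordinal.sSup_lt_of_lt_cof ?_ hS
      rw [← Ordinal.lift_cof]
      exact hcard.trans_lt (lift_lt.2 hμ)
    refine ⟨max (⨆ n, b n) (sSup S), max_lt hsupb hsupS, fun α hα => ?_, ?_⟩
    · exact le_max_of_le_right (le_csSup ⟨μ, fun a ha => (hS ha).le⟩ hα)
    · refine Disjoint.mono_left hKW ((disjoint_comm.1 ?_).closure_right hW)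
      refine hWV.symm.mono_left ?_
      rintro _ ⟨α, ⟨hα, hαμ⟩, rfl⟩
      refine mem_iInter.2 fun n => hb n α ?_ hαμ
      exact ((Ordinal.le_iSup b n).trans (le_max_left _ _)).trans hα
  choose! g hgμ hgS hgd using step
  -- Each index is chosen by `g` above all earlier ones, with the closure of the tail from it
  -- missing the closure of the earlier terms.
  let f : Ordinal.{u} → Ordinal.{u} :=
    WellFoundedLT.fix (motive := fun _ => Ordinal.{u}) fun β ih => g (range fun j : Iio β => ih j.1 j.2)
  have hf : ∀ β, f β = g (f '' Iio β) := by
    intro β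
    rw [image_eq_range]
    exact WellFoundedLT.fix_eq (motive := fun _ => Ordinal.{u}) _ β
  have hcard : ∀ β < (Order.succ κ).ord, #(f '' Iio β) ≤ lift.{u+1} κ := by
    intro β hβ
    refine mk_image_le.trans ?_
    rw [mk_Iio_ordinal]
    exact lift_le.2 (Order.lt_succ_iff.1 (lt_ord.1 hβ))
  have hfμ : ∀ β < (Order.succ κ).ord, f β < μ := by
    intro β
    induction β using WellFoundedLT.induction with
    | _ β ih =>
      intro hβ
      rw [hf]
      refine hgμ _ ?_ (hcard β hβ)
      rintro _ ⟨j, hj, rfl⟩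
      exact ih j hj (hj.trans hβ)
  have hsub : ∀ β < (Order.succ κ).ord, f '' Iio β ⊆ Iio μ := by
    rintro β hβ _ ⟨j, hj, rfl⟩
    exact hfμ j (lt_trans hj hβ)
  refine ⟨x ∘ f, fun β hβ => ?_⟩
  have hd := hgd _ (hsub β hβ) (hcard β hβ)
  rw [← hf] at hd
  rw [image_comp]
  refine hd.mono_right (closure_mono ?_)
  rintro _ ⟨α, ⟨hβα, hα⟩, rfl⟩
  refine ⟨f α, ⟨?_, hfμ α hα⟩, rfl⟩
  rcases hβα.eq_or_lt with rfl | hlt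
  · exact le_rfl
  · rw [hf α]
    exact hgS _ (hsub α hα) (hcard α hα) _ ⟨β, hlt, rfl⟩

theorem IsPseudoradial.tightnessLE {X : Type u} [TopologicalSpace X] [T2Space X] [LindelofSpace X]
    (hX : IsPseudoradial X) (hκ : ℵ₀ ≤ freeSequenceNumber X) :
    TightnessLE X (freeSequenceNumber X) := by
  intro A p hpA
  set κ := freeSequenceNumber X
  let A' : Set X := {q | ∃ B ⊆ A, #B ≤ κ ∧ q ∈ closure B}
  have hAA' : A ⊆ A' := fun q hq =>
    ⟨{q}, by simpa using hq, by simpa using one_le_aleph0.trans hκ, subset_closure rfl⟩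
  -- Since κ · κ = κ, passing to closures of sets of size at most κ twice gives nothing new.
  have hclosed : ∀ D ⊆ A', #D ≤ κ → closure D ⊆ A' := by
    intro D hD hDκ
    choose B hBA hBκ hqB using fun q : D => hD q.2
    intro r hr
    refine ⟨⋃ q, B q, iUnion_subset hBA, ?_, ?_⟩
    · exact (mk_iUnion_le _).trans
        ((mul_le_mul' hDκ (ciSup_le' hBκ)).trans_eq (mul_eq_self hκ))
    · refine closure_minimal ?_ isClosed_closure hr
      intro q hq
      exact closure_mono (subset_iUnion B ⟨q, hq⟩) (hqB ⟨q, hq⟩)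
  by_cases hA' : IsClosed A'
  · exact closure_minimal hAA' hA' hpA
  · exfalso
    obtain ⟨q, ⟨-, hq⟩, μ, x, hxA, hconv⟩ := hX A' hA'
    have himg : x '' Iio μ ⊆ A' := by
      rintro _ ⟨α, hα, rfl⟩
      exact hxA α hα
    have hno : ∀ B ⊆ x '' Iio μ, #B ≤ κ → q ∉ closure B :=
      fun B hB hBκ hqB => hq (hclosed B (hB.trans himg) hBκ hqB)
    have hμ : κ < μ.cof := by
      by_contra! hle
      obtain ⟨B, hB, hBκ, hqB⟩ := hconv.exists_mk_le hle
      exact hno B hB hBκ hqB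
    obtain ⟨y, hy⟩ := exists_isFreeSequence_of_transfiniteConverges hκ hconv hμ hno
    have := hy.card_le
    rw [card_ord] at this
    exact (Order.lt_succ κ).not_ge this

/-! ### Covers and closures in the G_δ-modification -/

theorem TightnessLE.exists_notMem_closure {X : Type u} [TopologicalSpace X] [T2Space X]
    {κ : Cardinal.{u}} (hT : TightnessLE X κ) {C : Set X} {y z : X} (hy : y ∈ closure C)
    (hyz : y ≠ z) : ∃ B ⊆ C, #B ≤ κ ∧ y ∈ closure B ∧ z ∉ closure B := by
  obtain ⟨O, V, hO, hV, hyO, hzV, hOV⟩ := t2_separation hyz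
  obtain ⟨B, hB, hBκ, hyB⟩ := hT (O ∩ C) y (hO.inter_closure ⟨hyO, hy⟩)
  refine ⟨B, hB.trans inter_subset_right, hBκ, hyB, fun hz => ?_⟩
  exact ((hOV.mono_left (hB.trans inter_subset_left)).closure_left hV).ne_of_mem hz hzV rfl

/-- In a Lindelöf Hausdorff space of tightness at most `κ`, every cover by `G_δ`-sets, one around
each point, has a subcover of cardinality at most `2 ^ κ`. -/
theorem TightnessLE.exists_gDelta_subcover {X : Type u} [TopologicalSpace X] [T2Space X]
    [LindelofSpace X] {κ : Cardinal.{u}} (hκ : ℵ₀ ≤ κ) (hT : TightnessLE X κ)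
    (U : X → ℕ → Set X) (hU : ∀ p n, IsOpen (U p n)) (hpU : ∀ p n, p ∈ U p n) :
    ∃ C : Set X, #C ≤ 2 ^ κ ∧ ∀ q, ∃ p ∈ C, ∀ n, q ∈ U p n := by
  rcases isEmpty_or_nonempty X with hX | ⟨⟨a⟩⟩
  · exact ⟨∅, by simp, fun q => isEmptyElim q⟩
  have h₁ : ∀ B : ℕ → Set X, ∃ p, (∃ p', ⋂ n, closure (B n) ⊆ ⋂ n, U p' n) →
      ⋂ n, closure (B n) ⊆ ⋂ n, U p n := by
    intro B
    by_cases h : ∃ p', ⋂ n, closure (B n) ⊆ ⋂ n, U p' n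
    · exact ⟨h.choose, fun _ => h.choose_spec⟩
    · exact ⟨a, fun h' => absurd h' h⟩
  have h₂ : ∀ (B : ℕ → Set X) (s : ℕ → ℕ), ∃ q, (∃ q', q' ∉ ⋃ n, ⋃ p ∈ B n, U p (s n)) →
      q ∉ ⋃ n, ⋃ p ∈ B n, U p (s n) := by
    intro B s
    by_cases h : ∃ q', q' ∉ ⋃ n, ⋃ p ∈ B n, U p (s n)
    · exact ⟨h.choose, fun _ => h.choose_spec⟩
    · exact ⟨a, fun h' => absurd h' h⟩
  -- Closure under `c₁` makes `C` cover its own closure; closure under `c₂` rules out a point left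
  -- uncovered.
  choose c₁ hc₁ using h₁
  choose c₂ hc₂ using h₂
  have hΦ : ∀ B, #({c₁ B} ∪ range (c₂ B) : Set X) ≤ 2 ^ κ := by
    intro B
    have hℵ := aleph0_le_two_power hκ
    refine (mk_union_le _ _).trans (add_le_of_le hℵ ?_ ?_)
    · rw [mk_singleton]
      exact one_le_aleph0.trans hℵ
    · have h := mk_range_le_lift (f := c₂ B)
      simp only [lift_uzero, mk_arrow, mk_nat, aleph0_power_aleph0,
        lift_continuum] at h
      refine h.trans ?_
      rw [← two_power_aleph0]
      exact power_le_power_left two_ne_zero hκ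
  obtain ⟨C, haC, hC, hclosed⟩ := exists_closed_under hκ (fun B => {c₁ B} ∪ range (c₂ B)) hΦ a
  have hcover : ∀ y ∈ closure C, ∃ p ∈ C, ∀ n, y ∈ U p n := by
    intro y hy
    let ι := {B : Set X // B ⊆ C ∧ #B ≤ κ ∧ y ∈ closure B}
    have : Nonempty ι := let ⟨B, h⟩ := hT C y hy; ⟨⟨B, h⟩⟩
    have hf : ∀ n, ∃ f : ℕ → ι, (U y n)ᶜ ⊆ ⋃ m, (closure (f m).1)ᶜ := by
      intro n
      refine (hU y n).isClosed_compl.isLindelof.indexed_countable_subcover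
        (fun B : ι => (closure B.1)ᶜ) (fun B => isClosed_closure.isOpen_compl) ?_
      intro z hz
      have hyz : y ≠ z := by
        rintro rfl
        exact hz (hpU y n)
      obtain ⟨B, hB, hBκ, hyB, hzB⟩ := hT.exists_notMem_closure hy hyz
      exact mem_iUnion.2 ⟨⟨B, hB, hBκ, hyB⟩, hzB⟩
    choose f hf using hf
    -- Pairing merges the countable families for all `n` into one sequence, a legitimate argument of
    -- `c₁`.
    let B : ℕ → Set X := fun k => (f k.unpair.1 k.unpair.2).1
    have hB : ⋂ k, closure (B k) ⊆ ⋂ n, U y n := by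
      intro z hz
      refine mem_iInter.2 fun n => ?_
      by_contra hzn
      obtain ⟨m, hm⟩ := mem_iUnion.1 (hf n hzn)
      refine hm ?_
      have := mem_iInter.1 hz (Nat.pair n m)
      simpa [B] using this
    have hmem : c₁ B ∈ C := hclosed B (fun k => (f _ _).2.1) (fun k => (f _ _).2.2.1) (Or.inl rfl)
    have hyB : y ∈ ⋂ k, closure (B k) := mem_iInter.2 fun k => (f _ _).2.2.2
    exact ⟨c₁ B, hmem, fun n => mem_iInter.1 (hc₁ B ⟨y, hB⟩ hyB) n⟩
  refine ⟨C, hC, fun q => ?_⟩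
  by_contra! hq
  choose! s hs using hq
  have : Nonempty C := ⟨⟨a, haC⟩⟩
  -- Countably many sets `U p (s p)` cover `closure C` but miss `q`, so `c₂` yields a point of `C`
  -- outside them.
  obtain ⟨g, hg⟩ := (isClosed_closure (s := C)).isLindelof.indexed_countable_subcover
    (fun p : C => U p (s p)) (fun p => hU _ _) (fun y hy =>
      let ⟨p, hpC, hp⟩ := hcover y hy
      mem_iUnion.2 ⟨⟨p, hpC⟩, hp _⟩)
  have hmem : c₂ (fun n => {(g n).1}) (fun n => s (g n)) ∈ C :=
    hclosed (fun n => {(g n).1}) (fun n => by simp)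
      (fun n => by simpa using one_le_aleph0.trans hκ) (Or.inr ⟨_, rfl⟩)
  refine hc₂ (fun n => {(g n).1}) (fun n => s (g n)) ⟨q, ?_⟩ ?_
  · simpa using fun n => hs (g n) (g n).2
  · simpa using hg (subset_closure hmem)

/-- The `G_δ`-modification of a Lindelöf Hausdorff space of tightness at most `κ` has tightness
at most `2 ^ κ`. -/
theorem TightnessLE.exists_gDelta_closure {X : Type u} [TopologicalSpace X] [T2Space X]
    [LindelofSpace X] {κ : Cardinal.{u}} (hκ : ℵ₀ ≤ κ) (hT : TightnessLE X κ) {A : Set X} {p : X}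
    (hp : ∀ s, IsGδ s → p ∈ s → (s ∩ A).Nonempty) :
    ∃ D ⊆ A, #D ≤ 2 ^ κ ∧ ∀ s, IsGδ s → p ∈ s → (s ∩ D).Nonempty := by
  have hsep : ∀ B : Set X, ∃ H, IsGδ H ∧ p ∈ H ∧
      (p ∉ closure B → ∃ W, IsOpen W ∧ closure B ⊆ W ∧ Disjoint W H) := by
    intro B
    by_cases hB : p ∈ closure B
    · exact ⟨univ, .univ, mem_univ p, fun h => absurd hB h⟩
    · obtain ⟨V, hV, hpV, hW⟩ := exists_separation_of_isClosed isClosed_closure hB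
      exact ⟨⋂ n, V n, .iInter_of_isOpen hV, mem_iInter.2 hpV, fun _ => hW⟩
  choose H hH hpH hW using hsep
  have hpick : ∀ B : ℕ → Set X, ((⋂ n, H (B n)) ∩ A).Nonempty :=
    fun B => hp _ (.iInter fun n => hH _) (mem_iInter.2 fun n => hpH _)
  choose c hcH hcA using hpick
  obtain ⟨a, -, haA⟩ := hp univ .univ (mem_univ p)
  obtain ⟨C, haC, hC, hclosed⟩ := exists_closed_under hκ (fun B => {c B})
    (fun B => by simpa using one_le_aleph0.trans (aleph0_le_two_power hκ)) a
  refine ⟨C ∩ A, inter_subset_right, (mk_le_mk_of_subset inter_subset_left).trans hC, ?_⟩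
  intro s hs hps
  by_contra hempty
  obtain ⟨U, hU, rfl⟩ := isGδ_iff_eq_iInter_nat.1 hs
  let ι := {B : Set X // B ⊆ C ∩ A ∧ #B ≤ κ ∧ p ∉ closure B}
  have : Nonempty ι := ⟨⟨∅, by simp⟩⟩
  choose W hWo hBW hWH using fun B : ι => hW B.1 B.2.2.2
  have hf : ∀ n, ∃ f : ℕ → ι, closure (C ∩ A) \ U n ⊆ ⋃ m, W (f m) := by
    intro n
    refine (isClosed_closure.sdiff (hU n)).isLindelof.indexed_countable_subcover W hWo ?_
    rintro y ⟨hy, hyU⟩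
    have hyp : y ≠ p := by
      rintro rfl
      exact hyU (mem_iInter.1 hps n)
    obtain ⟨B, hB, hBκ, hyB, hpB⟩ := hT.exists_notMem_closure hy hyp
    exact mem_iUnion.2 ⟨⟨B, hB, hBκ, hpB⟩, hBW _ hyB⟩
  choose f hf using hf
  let B : ℕ → Set X := fun k => (f k.unpair.1 k.unpair.2).1
  have hmem : c B ∈ C ∩ A :=
    ⟨hclosed B (fun k => (f _ _).2.1.trans inter_subset_left) (fun k => (f _ _).2.2.1) rfl, hcA B⟩
  refine hempty ⟨c B, mem_iInter.2 fun n => ?_, hmem⟩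
  by_contra hn
  -- Outside `U n`, the point `c B` lies in some `W (f n m)`, which is disjoint from the set `H`
  -- containing it.
  obtain ⟨m, hm⟩ := mem_iUnion.1 (hf n ⟨subset_closure hmem, hn⟩)
  have := mem_iInter.1 (hcH B) (Nat.pair n m)
  simp only [B, Nat.unpair_pair] at this
  exact (hWH _).ne_of_mem hm this rfl

/-! ### The bound on free sequences -/

theorem mem_closure_gDeltaModification {X : Type u} [TopologicalSpace X]
    {A : Set (GDeltaModification X)} {p : GDeltaModification X} :
    p ∈ closure A ↔ ∀ s : Set X, IsGδ s → p ∈ s → (s ∩ A : Set X).Nonempty := by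
  have hbasis : TopologicalSpace.IsTopologicalBasis
      (α := GDeltaModification X) {s : Set X | IsGδ s} :=
    { exists_subset_inter := fun s hs t ht x hx => ⟨s ∩ t, IsGδ.inter hs ht, hx, subset_rfl⟩
      sUnion_eq := eq_univ_of_forall fun x => mem_sUnion.2 ⟨univ, IsGδ.univ (X := X), mem_univ x⟩
      eq_generateFrom := rfl }
  exact hbasis.mem_closure_iff

/-- A free sequence in the `G_δ`-modification of a Lindelöf Hausdorff space of infinite tightness
at most `κ` is not longer than `2 ^ κ`. -/
theorem TightnessLE.card_le_of_isFreeSequence {X : Type u} [TopologicalSpace X] [T2Space X]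
    [LindelofSpace X] {κ : Cardinal.{u}} (hκ : ℵ₀ ≤ κ) (hT : TightnessLE X κ)
    {ν : Ordinal.{u}} {x : Ordinal.{u} → GDeltaModification X} (hx : IsFreeSequence ν x) :
    ν.card ≤ 2 ^ κ := by
  by_contra! hν
  set o := (Order.succ ((2 : Cardinal.{u}) ^ κ)).ord with ho
  have hreg := isRegular_succ (aleph0_le_two_power hκ)
  have hcof : (2 : Cardinal.{u}) ^ κ < o.cof := by
    rw [ho, hreg.cof_ord]
    exact Order.lt_succ _
  have hxo : IsFreeSequence o x := hx.mono (ord_le.2 (Order.succ_le_of_lt hν))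
  have hlim : ∃ p : X, ∀ β < o, ∀ s : Set X, IsGδ s → p ∈ s →
      (s ∩ (x '' Ico β o : Set X) : Set X).Nonempty := by
    by_contra! hno
    choose b hb s hs hps hdisj using hno
    choose U hU hsU using fun p => isGδ_iff_eq_iInter_nat.1 (hs p)
    obtain ⟨C, hC, hcover⟩ := hT.exists_gDelta_subcover hκ U hU fun p n => by
      have := hps p
      rw [hsU] at this
      exact mem_iInter.1 this n
    -- If each point had a G_δ-set missing a tail, 2^κ of these sets would cover X and all miss a
    -- common tail.
    have hsup : (⨆ p : C, b p) < o :=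
      Ordinal.iSup_lt_of_lt_cof (hC.trans_lt hcof) fun p => hb p
    obtain ⟨p, hpC, hp⟩ := hcover (x (⨆ p : C, b p))
    have hmem : x (⨆ p : C, b p) ∈ s p := by
      rw [hsU]
      exact mem_iInter.2 hp
    exact (hdisj p).subset
      ⟨hmem, _, ⟨Ordinal.le_iSup (fun p : C => b p) ⟨p, hpC⟩, hsup⟩, rfl⟩
  obtain ⟨p, hp⟩ := hlim
  obtain ⟨D, hDA, hD, hpD⟩ := hT.exists_gDelta_closure hκ (hp 0 hreg.ord_pos)
  choose i hi hxi using hDA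
  have hsup : (⨆ d : D, i d.2 + 1) < o :=
    Ordinal.iSup_add_one_lt_of_lt_cof (hD.trans_lt hcof) fun d => (hi d.2).2
  refine (hxo _ hsup).ne_of_mem (a := p) (b := p)
    (mem_closure_gDeltaModification.2 fun s hs hps => ?_)
    (mem_closure_gDeltaModification.2 (hp _ hsup)) rfl
  obtain ⟨d, hds, hdD⟩ := hpD s hs hps
  refine ⟨d, hds, i hdD, ?_, hxi hdD⟩
  have := Ordinal.le_iSup (fun d : D => i d.2 + 1) ⟨d, hdD⟩
  exact lt_of_lt_of_le (lt_add_of_pos_right _ zero_lt_one) this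

/-- Any finitely many points of a `T₁` space form a free sequence. -/
theorem natCast_le_freeSequenceNumber {X : Type u} [TopologicalSpace X] [T1Space X] {n : ℕ}
    (hn : (n : Cardinal.{u}) ≤ #X) : (n : Cardinal.{u}) ≤ freeSequenceNumber X := by
  rcases Nat.eq_zero_or_pos n with rfl | hpos
  · simp
  have : Nonempty X := mk_ne_zero_iff.1 fun h => by
    rw [h] at hn
    exact hpos.ne' (by simpa using hn)
  obtain ⟨e⟩ : Nonempty (Fin n ↪ X) := by
    rw [← lift_mk_le']
    simpa using hn
  -- Only the values below `n` matter.
  let x : Ordinal.{u} → X := fun α =>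
    if h : toNat α.card < n then e ⟨_, h⟩ else Classical.arbitrary X
  have hnat : ∀ α < (n : Ordinal.{u}), ∃ m < n, α = (m : Ordinal.{u}) := by
    intro α hα
    obtain ⟨m, rfl⟩ := Ordinal.lt_omega0.1 (hα.trans (Ordinal.natCast_lt_omega0 n))
    exact ⟨m, by exact_mod_cast hα, rfl⟩
  have hxe : ∀ m (hm : m < n), x (m : Ordinal.{u}) = e ⟨m, hm⟩ := by
    intro m hm
    simp [x, hm]
  have hfin : (x '' Iio (n : Ordinal.{u})).Finite := by
    refine (finite_range e).subset ?_
    rintro _ ⟨α, hα, rfl⟩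
    obtain ⟨m, hm, rfl⟩ := hnat α hα
    exact ⟨_, (hxe m hm).symm⟩
  have hfree : IsFreeSequence (n : Ordinal.{u}) x := by
    intro β hβ
    have h1 : (x '' Iio β).Finite := hfin.subset (image_mono (Iio_subset_Iio hβ.le))
    have h2 : (x '' Ico β n).Finite := hfin.subset (image_mono Ico_subset_Iio_self)
    rw [h1.isClosed.closure_eq, h2.isClosed.closure_eq, Set.disjoint_left]
    rintro _ ⟨α, hα, rfl⟩ ⟨γ, ⟨hβγ, hγ⟩, h⟩
    obtain ⟨k, hk, rfl⟩ := hnat α (lt_trans hα hβ)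
    obtain ⟨m, hm, rfl⟩ := hnat γ hγ
    rw [hxe k hk, hxe m hm] at h
    have hkm : m = k := congrArg Fin.val (e.injective h)
    exact (lt_of_lt_of_le hα hβγ).ne (by rw [hkm])
  simpa using hfree.card_le

theorem corollary3p4 (X : Type u) [TopologicalSpace X] [T2Space X] [LindelofSpace X]
    (hX : IsPseudoradial X) :
    freeSequenceNumber (GDeltaModification X) ≤ 2 ^ freeSequenceNumber X := by
  refine csSup_le' ?_
  rintro c ⟨ν, x, hx, rfl⟩
  by_cases hfin : #X < ℵ₀
  · obtain ⟨n, hn⟩ := lt_aleph0.1 hfin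
    refine (mk_set_le _).trans ((cantor (#X)).le.trans (power_le_power_left two_ne_zero ?_))
    rw [hn]
    exact natCast_le_freeSequenceNumber hn.ge
  · have hκ : ℵ₀ ≤ freeSequenceNumber X :=
      aleph0_le.2 fun n => natCast_le_freeSequenceNumber (natCast_le_aleph0.trans (not_lt.1 hfin))
    rw [hx.mk_image]
    exact (hX.tightnessLE hκ).card_le_of_isFreeSequence hκ hx
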